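/- Let $k$ be an algebraically closed field of characteristic $0$, let $N\ge 3$, and let $A=k[x_1,\dots,x_N]/\langle x_1^2+\dots+x_N^2-1\rangle$ be the algebra of polynomial functions on the sphere $S^{N-1}$. For $1\le a,b\le N$ let $\Delta_{ab}=x_b\,\partial/\partial x_a-x_a\,\partial/\partial x_b$, regarded as a derivation of $A$, and let $\tau$ be the linear map from $N\times N$ matrices over $k$ to derivations of $A$ determined by $\tau(E_{ab})=\sum_{p=1}^N x_bx_p\Delta_{ap}$. Then $X\cdot f=-\tau(X)f$ defines an action of the Lie algebra $\mathfrak{sl}_N(k)$ on $A$ by derivations (the infinitesimal form of the action $v\mapsto gv/|gv|$ on the sphere). Let $A_{odd}$ (resp. $A_{ev}$) be the subspace of $A$ spanned by the monomials of odd (resp. even) degree. Then, as an $\mathfrak{sl}_N(k)$-module, $A$ is the direct sum of two submodules, $A=A_{odd}\oplus A_{ev}$. The module $A_{odd}$ is irreducible, and $A_{ev}$ has exactly one submodule different from $0$ and $A_{ev}$; it is one-dimensional and consists of the constant functions. -/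

import Mathlib

noncomputable section

namespace SphereVF

open MvPolynomial

variable (N : ℕ) (k : Type*) [Field k]

/-- The algebra of polynomial functions on the sphere:
`A = k[x_1, …, x_N] / ⟨x_1² + ⋯ + x_N² - 1⟩`. -/
abbrev SphereAlg : Type _ :=
  MvPolynomial (Fin N) k ⧸
    Ideal.span ({(∑ i : Fin N, X i ^ 2) - 1} : Set (MvPolynomial (Fin N) k))

/-- The quotient map `k[x_1, …, x_N] → A`. -/
abbrev toSphere : MvPolynomial (Fin N) k →ₐ[k] SphereAlg N k :=
  Ideal.Quotient.mkₐ k _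

variable {N k} in
/-- The `i`-th coordinate function on the sphere. -/
def coord (i : Fin N) : SphereAlg N k := toSphere N k (X i)

theorem sum_coord_sq : ∑ i : Fin N, (coord i : SphereAlg N k) ^ 2 = 1 := by
  have h : toSphere N k ((∑ i : Fin N, X i ^ 2) - 1) = 0 :=
    Ideal.Quotient.eq_zero_iff_mem.mpr (Ideal.subset_span rfl)
  rw [map_sub, map_sum, map_one, sub_eq_zero] at h
  simpa [coord] using h

variable {N k} in
/-- The vector field `x_b ∂/∂x_a - x_a ∂/∂x_b` on affine space. -/
def rotPoly (a b : Fin N) : Derivation k (MvPolynomial (Fin N) k) (MvPolynomial (Fin N) k) :=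
  (X b : MvPolynomial (Fin N) k) • pderiv a - (X a : MvPolynomial (Fin N) k) • pderiv b

theorem rotPoly_X (a b c : Fin N) :
    rotPoly a b (X c : MvPolynomial (Fin N) k) =
      (if c = a then X b else 0) - (if c = b then X a else 0) := by
  simp [rotPoly, pderiv_X, Pi.single_apply]

theorem rotPoly_eqn (a b : Fin N) :
    rotPoly a b ((∑ i : Fin N, X i ^ 2) - 1 : MvPolynomial (Fin N) k) = 0 := by
  have h : ∀ i : Fin N, rotPoly a b (X i ^ 2 : MvPolynomial (Fin N) k) =
      (if i = a then 2 * X i * X b else 0) - (if i = b then 2 * X i * X a else 0) := by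
    intro i
    rw [Derivation.leibniz_pow, rotPoly_X]
    split_ifs <;> simp <;> ring
  rw [map_sub, map_sum, Derivation.map_one_eq_zero, sub_zero]
  simp only [h, Finset.sum_sub_distrib, Finset.sum_ite_eq', Finset.mem_univ, if_true]
  ring

theorem toSphere_rotPoly (a b : Fin N) (f : MvPolynomial (Fin N) k)
    (hf : toSphere N k f = 0) : toSphere N k (rotPoly a b f) = 0 := by
  rw [Ideal.Quotient.mkₐ_eq_mk, Ideal.Quotient.eq_zero_iff_mem] at hf ⊢
  obtain ⟨g, rfl⟩ := Ideal.mem_span_singleton'.mp hf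
  rw [Derivation.leibniz, rotPoly_eqn, smul_zero, zero_add, smul_eq_mul]
  exact Ideal.mul_mem_right _ _ (Ideal.subset_span rfl)

variable {N k} in
/-- The vector field `Δ_ab = x_b ∂/∂x_a - x_a ∂/∂x_b` on the sphere, as a derivation of `A`. -/
def rot (a b : Fin N) : Derivation k (SphereAlg N k) (SphereAlg N k) :=
  Derivation.liftOfSurjective (f := toSphere N k) (Ideal.Quotient.mkₐ_surjective k _)
    (toSphere_rotPoly N k a b)

theorem rot_toSphere (a b : Fin N) (f : MvPolynomial (Fin N) k) :
    rot a b (toSphere N k f) = toSphere N k (rotPoly a b f) :=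
  Derivation.liftOfSurjective_apply (f := toSphere N k) _ (toSphere_rotPoly N k a b) f

theorem rot_coord (a b c : Fin N) :
    rot a b (coord c : SphereAlg N k) =
      (if c = a then coord b else 0) - (if c = b then coord a else 0) := by
  rw [coord, rot_toSphere, rotPoly_X, map_sub, apply_ite (toSphere N k),
    apply_ite (toSphere N k), map_zero]
  rfl

/-- The linear map from matrices to vector fields on the sphere determined by
`E_ab ↦ ∑_p x_b x_p Δ_ap`. It takes `E_ab - E_ba` to `Δ_ab`. Its value at `M` is the
velocity field at `t = 0` of the motion `v ↦ exp(tM) v / |exp(tM) v|`. -/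
def tau : Matrix (Fin N) (Fin N) k →ₗ[k] Derivation k (SphereAlg N k) (SphereAlg N k) where
  toFun M := ∑ a, ∑ b, M a b • ∑ p, (coord b * coord p : SphereAlg N k) • rot a p
  map_add' M M' := by simp only [Matrix.add_apply, add_smul, Finset.sum_add_distrib]
  map_smul' c M := by
    simp only [Matrix.smul_apply, smul_eq_mul, mul_smul, Finset.smul_sum, RingHom.id_apply]

theorem derivation_sum_apply {ι : Type*} (s : Finset ι)
    (D : ι → Derivation k (SphereAlg N k) (SphereAlg N k)) (f : SphereAlg N k) :
    (∑ i ∈ s, D i) f = ∑ i ∈ s, D i f := by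
  classical
  induction s using Finset.induction_on with
  | empty => simp
  | insert i s hi ih => rw [Finset.sum_insert hi, Finset.sum_insert hi, Derivation.add_apply, ih]

/-- The coordinate functions of `M v`. -/
def linPart (M : Matrix (Fin N) (Fin N) k) (c : Fin N) : SphereAlg N k :=
  ∑ b, M c b • coord b

/-- The function `v ↦ ⟨v, M v⟩`. -/
def quadPart (M : Matrix (Fin N) (Fin N) k) : SphereAlg N k :=
  ∑ a, coord a * linPart N k M a

theorem tau_coord (M : Matrix (Fin N) (Fin N) k) (c : Fin N) :
    tau N k M (coord c) = linPart N k M c - quadPart N k M * coord c := by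
  have h1 : ∀ a b : Fin N,
      (∑ p, (coord b * coord p : SphereAlg N k) • rot a p :
          Derivation k (SphereAlg N k) (SphereAlg N k)) (coord c) =
        (if c = a then (coord b : SphereAlg N k) else 0) - coord a * coord b * coord c := by
    intro a b
    have h2 : ∀ p : Fin N, (coord b * coord p : SphereAlg N k) * rot a p (coord c) =
        (if c = a then coord b else 0) * coord p ^ 2 -
          (if c = p then coord a * coord b * coord p else 0) := by
      intro p
      rw [rot_coord]
      split_ifs <;> ring
    rw [derivation_sum_apply]
    simp only [Derivation.smul_apply, smul_eq_mul, h2, Finset.sum_sub_distrib,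
      ← Finset.mul_sum, sum_coord_sq, mul_one, Finset.sum_ite_eq, Finset.mem_univ, if_true]
  have h3 : tau N k M (coord c) = ∑ a, ∑ b, M a b •
      ((if c = a then (coord b : SphereAlg N k) else 0) - coord a * coord b * coord c) := by
    simp only [← h1]
    change (∑ a, ∑ b, M a b • ∑ p, (coord b * coord p : SphereAlg N k) • rot a p :
      Derivation k (SphereAlg N k) (SphereAlg N k)) (coord c) = _
    simp only [derivation_sum_apply N k Finset.univ, Derivation.smul_apply]
  rw [h3]
  simp only [linPart, quadPart, smul_sub, Finset.sum_sub_distrib, smul_ite, smul_zero,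
    Finset.sum_mul, Finset.mul_sum, smul_mul_assoc, mul_smul_comm]
  congr 1
  rw [Finset.sum_comm]
  simp

theorem tau_linPart (M M' : Matrix (Fin N) (Fin N) k) (c : Fin N) :
    tau N k M (linPart N k M' c) =
      linPart N k (M' * M) c - quadPart N k M * linPart N k M' c := by
  have h : tau N k M (linPart N k M' c) = ∑ b, M' c b • tau N k M (coord b) := by
    rw [linPart, map_sum]
    simp only [Derivation.map_smul]
  rw [h]
  simp only [tau_coord, smul_sub, Finset.sum_sub_distrib]
  congr 1
  · simp only [linPart, Matrix.mul_apply, Finset.sum_smul, Finset.smul_sum, mul_smul]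
    exact Finset.sum_comm
  · simp only [linPart, Finset.mul_sum, mul_smul_comm]

theorem tau_quadPart (M M' : Matrix (Fin N) (Fin N) k) :
    tau N k M (quadPart N k M') = (∑ a, linPart N k M a * linPart N k M' a) +
      quadPart N k (M' * M) - 2 * (quadPart N k M * quadPart N k M') := by
  have h : ∀ a, tau N k M (coord a * linPart N k M' a) =
      linPart N k M a * linPart N k M' a + coord a * linPart N k (M' * M) a -
        2 * (quadPart N k M * (coord a * linPart N k M' a)) := by
    intro a
    rw [Derivation.leibniz, tau_coord, tau_linPart, smul_eq_mul, smul_eq_mul]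
    ring
  calc tau N k M (quadPart N k M') = ∑ a, tau N k M (coord a * linPart N k M' a) := by
        rw [quadPart, map_sum]
    _ = _ := by
        simp only [h, Finset.sum_sub_distrib, Finset.sum_add_distrib, ← Finset.mul_sum]
        rfl

theorem derivation_ext_coord {D D' : Derivation k (SphereAlg N k) (SphereAlg N k)}
    (h : ∀ i, D (coord i) = D' (coord i)) : D = D' := by
  ext f
  obtain ⟨p, rfl⟩ := Ideal.Quotient.mkₐ_surjective k _ f
  change D (toSphere N k p) = D' (toSphere N k p)
  induction p using MvPolynomial.induction_on with
  | C a =>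
    have : toSphere N k (C a) = algebraMap k _ a := (toSphere N k).commutes a
    rw [this, Derivation.map_algebraMap, Derivation.map_algebraMap]
  | add p q hp hq => rw [map_add, map_add, map_add, hp, hq]
  | mul_X p i hp =>
    have hi : D (toSphere N k (X i)) = D' (toSphere N k (X i)) := h i
    rw [map_mul, Derivation.leibniz, Derivation.leibniz, hp, hi]

/-- Vector fields of matrices: passing to velocity fields reverses brackets. -/
theorem tau_lie (M M' : Matrix (Fin N) (Fin N) k) :
    ⁅tau N k M, tau N k M'⁆ = -tau N k (M * M' - M' * M) := by
  apply derivation_ext_coord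
  intro c
  have hS : (∑ a, linPart N k M' a * linPart N k M a) =
      ∑ a, linPart N k M a * linPart N k M' a :=
    Finset.sum_congr rfl fun a _ => mul_comm _ _
  rw [map_sub, neg_sub, Derivation.commutator_apply, Derivation.sub_apply]
  simp only [tau_coord, map_sub, Derivation.leibniz, smul_eq_mul, tau_linPart, tau_quadPart, hS]
  ring

/-- The action of `sl_N` on `A` by infinitesimal transformations: `X` acts by `-τ(X)`, the
derivative at `t = 0` of `f ↦ f ∘ exp(-tX)` for the action `g · v = g v / |g v|`.
The sign is what makes this a homomorphism for the commutator bracket of derivations. -/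
def slHom : LieAlgebra.SpecialLinear.sl (Fin N) k →ₗ⁅k⁆
    Derivation k (SphereAlg N k) (SphereAlg N k) where
  toFun M := -tau N k M.val
  map_add' M M' := by
    change -tau N k (M.val + M'.val) = _
    ext f
    simp only [map_add, Derivation.neg_apply, Derivation.add_apply]
    ring
  map_smul' c M := by
    change -tau N k (c • M.val) = _
    ext f
    simp only [map_smul, Derivation.neg_apply, Derivation.smul_apply, RingHom.id_apply, smul_neg]
  map_lie' {M M'} := by
    change -tau N k (M.val * M'.val - M'.val * M.val) = ⁅-tau N k M.val, -tau N k M'.val⁆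
    rw [← tau_lie]
    ext f
    simp only [Derivation.commutator_apply, Derivation.neg_apply, map_neg]
    ring

instance slLieRingModule :
    LieRingModule (LieAlgebra.SpecialLinear.sl (Fin N) k) (SphereAlg N k) :=
  LieRingModule.compLieHom (SphereAlg N k) (slHom N k)

instance slLieModule :
    LieModule k (LieAlgebra.SpecialLinear.sl (Fin N) k) (SphereAlg N k) :=
  LieModule.compLieHom (SphereAlg N k) (slHom N k)

/-- `A_odd`: the span of the images in `A` of the monomials of odd total degree. -/
def oddPart : Submodule k (SphereAlg N k) :=
  Submodule.span k {f | ∃ s : Fin N →₀ ℕ, Odd s.degree ∧ f = toSphere N k (monomial s 1)}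

/-- `A_ev`: the span of the images in `A` of the monomials of even total degree. -/
def evenPart : Submodule k (SphereAlg N k) :=
  Submodule.span k {f | ∃ s : Fin N →₀ ℕ, Even s.degree ∧ f = toSphere N k (monomial s 1)}

end SphereVF

end

/-! On the sphere `radSq` is 1, so a sum of monomials of one parity has a homogeneous representative
(`exists_isEuler`), and on that representative `τ(E_ab)` is x_b ∂_a - x_a x_b E, with E the Euler
operator (`tau_toSphere`). Hence parity is preserved; the antipodal map separates the two parts.

Let W be a stable subspace. The antisymmetric matrices act by rotations, whose Casimir operator
makes W closed under the Laplacian of homogeneous representatives (`TauStable.lap_mem`); so the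
harmonic components of an element of W lie in W. The symmetric traceless matrices act on a harmonic
p of degree l ≥ 1 by mixing degrees l + 2, l and l - 2. Laplacians separate these terms, so W
contains every x_a x_b p (`X_mul_X_mul_mem`) and every ∂_a ∂_b p (`pderiv_pderiv_mem`). For l = 0
the action is zero, which is why the constants form a submodule.

A nonconstant element of W thus leads down to a nonzero harmonic of degree 1 or 2. Rotations, with N
≥ 3, turn it into all linear or all quadratic forms; multiplication by x_a x_b then fills the whole
parity part (`parityPart_le`). -/

noncomputable section

namespace SphereVF

open MvPolynomial

/-! ### Laplace and Euler operators, homogeneity, harmonic decomposition -/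

section Polynomials

variable {N : ℕ} {k : Type*} [Field k]

/-- The square of the radius. -/
def radSq : MvPolynomial (Fin N) k := ∑ i, X i ^ 2

/-- The Laplace operator. -/
def lap : MvPolynomial (Fin N) k →ₗ[k] MvPolynomial (Fin N) k :=
  ∑ i, (pderiv i).toLinearMap ∘ₗ (pderiv i).toLinearMap

/-- The Euler operator. -/
def euler : MvPolynomial (Fin N) k →ₗ[k] MvPolynomial (Fin N) k :=
  ∑ i, LinearMap.mulLeft k (X i) ∘ₗ (pderiv i).toLinearMap

theorem lap_apply (p : MvPolynomial (Fin N) k) : lap p = ∑ i, pderiv i (pderiv i p) := by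
  simp [lap]

theorem euler_apply (p : MvPolynomial (Fin N) k) : euler p = ∑ i, X i * pderiv i p := by
  simp [euler]

/-- A commutator of derivations is a derivation, so it is enough to look at the variables. -/
theorem pderiv_comm (i j : Fin N) (p : MvPolynomial (Fin N) k) :
    pderiv i (pderiv j p) = pderiv j (pderiv i p) := by
  have h : ⁅(pderiv i : Derivation k (MvPolynomial (Fin N) k) (MvPolynomial (Fin N) k)),
      (pderiv j : Derivation k (MvPolynomial (Fin N) k) (MvPolynomial (Fin N) k))⁆ = 0 := by
    apply MvPolynomial.derivation_ext
    intro l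
    rw [Derivation.commutator_apply]
    simp only [pderiv_X, Pi.single_apply]
    split_ifs <;> simp
  have := congrArg (fun D => D p) h
  simpa [Derivation.commutator_apply, sub_eq_zero] using this

theorem pderiv_X_mul (i j : Fin N) (p : MvPolynomial (Fin N) k) :
    pderiv i (X j * p) = X j * pderiv i p + if i = j then p else 0 := by
  rw [Derivation.leibniz, pderiv_X, Pi.single_apply]
  by_cases h : i = j
  · simp [h]
  · simp [h, Ne.symm h]

theorem lap_X_mul (a : Fin N) (p : MvPolynomial (Fin N) k) :
    lap (X a * p) = X a * lap p + 2 * pderiv a p := by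
  have h : ∀ i, pderiv i (pderiv i (X a * p)) =
      X a * pderiv i (pderiv i p) + 2 * (if i = a then pderiv i p else 0) := by
    intro i
    rw [pderiv_X_mul, map_add, pderiv_X_mul]
    split_ifs
    · ring
    · simp
  rw [lap_apply, lap_apply, Finset.sum_congr rfl fun i _ => h i, Finset.sum_add_distrib,
    ← Finset.mul_sum, ← Finset.mul_sum]
  simp

theorem lap_radSq_mul (p : MvPolynomial (Fin N) k) :
    lap (radSq * p) = radSq * lap p + 4 * euler p + 2 * (N : MvPolynomial (Fin N) k) * p := by
  have h : ∀ i : Fin N, lap (X i ^ 2 * p) =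
      X i ^ 2 * lap p + 4 * (X i * pderiv i p) + 2 * p := by
    intro i
    rw [pow_two, mul_assoc, lap_X_mul, lap_X_mul, pderiv_X_mul, if_pos rfl]
    ring
  rw [radSq, Finset.sum_mul, map_sum, Finset.sum_congr rfl fun i _ => h i,
    Finset.sum_add_distrib, Finset.sum_add_distrib, ← Finset.sum_mul, ← Finset.mul_sum,
    ← euler_apply]
  simp only [Finset.sum_const, Finset.card_univ, Fintype.card_fin, nsmul_eq_mul]
  ring

theorem pderiv_lap (i : Fin N) (p : MvPolynomial (Fin N) k) :
    pderiv i (lap p) = lap (pderiv i p) := by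
  simp only [lap_apply, map_sum]
  refine Finset.sum_congr rfl fun j _ => ?_
  rw [pderiv_comm i j, pderiv_comm i j]

theorem euler_mul (p q : MvPolynomial (Fin N) k) :
    euler (p * q) = euler p * q + p * euler q := by
  simp only [euler_apply, Derivation.leibniz, smul_eq_mul, Finset.sum_mul, Finset.mul_sum,
    ← Finset.sum_add_distrib]
  refine Finset.sum_congr rfl fun j _ => ?_
  ring

theorem euler_X (a : Fin N) : euler (X a : MvPolynomial (Fin N) k) = X a := by
  simp [euler_apply, pderiv_X, Pi.single_apply]

theorem euler_pderiv (a : Fin N) (p : MvPolynomial (Fin N) k) :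
    euler (pderiv a p) = pderiv a (euler p) - pderiv a p := by
  rw [euler_apply, euler_apply, map_sum, Finset.sum_congr rfl fun i _ => pderiv_X_mul a i _,
    Finset.sum_add_distrib]
  simp [pderiv_comm a]

/-- This is the Casimir operator of the rotation algebra; the factor 2 appears because each pair of
indices is counted in both orders. -/
theorem sum_rotPoly_rotPoly (p : MvPolynomial (Fin N) k) :
    ∑ a, ∑ b, rotPoly a b (rotPoly a b p) =
      2 * (radSq * lap p - euler (euler p) - ((N : MvPolynomial (Fin N) k) - 2) * euler p) := by
  have h : ∀ a b : Fin N, rotPoly a b (rotPoly a b p) =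
      X b ^ 2 * pderiv a (pderiv a p) + X a ^ 2 * pderiv b (pderiv b p)
        - X b * pderiv b p - X a * pderiv a p - 2 * (X a * (X b * pderiv a (pderiv b p)))
        + (if a = b then 2 * (X a * pderiv a p) else 0) := by
    intro a b
    simp only [rotPoly, Derivation.sub_apply, Derivation.smul_apply, smul_eq_mul, map_sub,
      pderiv_X_mul, pderiv_comm b a p]
    by_cases hab : a = b
    · subst hab
      simp
      ring
    · simp [hab, Ne.symm hab]
      ring
  have h2 : euler (euler p) = ∑ a, ∑ b, X a * (X b * pderiv a (pderiv b p)) + euler p := by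
    conv_lhs => rw [euler_apply p, euler_apply]
    simp only [map_sum, pderiv_X_mul, Finset.mul_sum, mul_add, Finset.sum_add_distrib]
    simp [euler_apply]
  have h3 : radSq * lap p = ∑ a : Fin N, ∑ b : Fin N, X a ^ 2 * pderiv b (pderiv b p) := by
    rw [radSq, lap_apply, Finset.sum_mul_sum]
  have h4 : radSq * lap p = ∑ a : Fin N, ∑ b : Fin N, X b ^ 2 * pderiv a (pderiv a p) := by
    rw [h3, Finset.sum_comm]
  simp only [h, Finset.sum_add_distrib, Finset.sum_sub_distrib]
  rw [← h3, ← h4, h2]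
  simp only [← Finset.mul_sum, Finset.sum_ite_eq, Finset.mem_univ, if_true, Finset.sum_const,
    Finset.card_univ, Fintype.card_fin, nsmul_eq_mul, ← euler_apply]
  rw [show ∑ a : Fin N, X a * ((N : MvPolynomial (Fin N) k) * pderiv a p) = N * euler p by
    rw [euler_apply, Finset.mul_sum]
    exact Finset.sum_congr rfl fun a _ => mul_left_comm _ _ _]
  ring

/-- `p` is homogeneous of degree `d`, as expressed by Euler's identity. -/
def IsEuler (d : k) (p : MvPolynomial (Fin N) k) : Prop := euler p = d • p

namespace IsEuler

variable {d e : k} {p q : MvPolynomial (Fin N) k}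

theorem add (hp : IsEuler d p) (hq : IsEuler d q) : IsEuler d (p + q) := by
  rw [IsEuler, map_add, hp, hq, smul_add]

theorem smul (c : k) (hp : IsEuler d p) : IsEuler d (c • p) := by
  rw [IsEuler, map_smul, hp, smul_comm]

theorem sub (hp : IsEuler d p) (hq : IsEuler d q) : IsEuler d (p - q) := by
  rw [IsEuler, map_sub, hp, hq, smul_sub]

theorem sum {ι : Type*} {s : Finset ι} {f : ι → MvPolynomial (Fin N) k}
    (h : ∀ i ∈ s, IsEuler d (f i)) : IsEuler d (∑ i ∈ s, f i) := by
  rw [IsEuler, map_sum, Finset.smul_sum]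
  exact Finset.sum_congr rfl h

theorem mul (hp : IsEuler d p) (hq : IsEuler e q) : IsEuler (d + e) (p * q) := by
  rw [IsEuler, euler_mul, hp, hq, add_smul, smul_mul_assoc, mul_smul_comm]

theorem X_mul (a : Fin N) (hp : IsEuler d p) : IsEuler (d + 1) (X a * p) := by
  rw [add_comm]
  exact mul (by rw [IsEuler, euler_X, one_smul]) hp

theorem radSq_mul (hp : IsEuler d p) : IsEuler (d + 2) (radSq * p) := by
  rw [radSq, Finset.sum_mul]
  refine sum fun i _ => ?_
  rw [pow_two, mul_assoc, ← one_add_one_eq_two, ← add_assoc]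
  exact (hp.X_mul i).X_mul i

theorem radSq_pow_mul (hp : IsEuler d p) (n : ℕ) :
    IsEuler (d + 2 * n) (radSq ^ n * p) := by
  induction n with
  | zero => simpa using hp
  | succ n ih =>
    have := ih.radSq_mul
    rw [pow_succ', mul_assoc]
    convert this using 1
    push_cast
    ring

theorem pderiv (a : Fin N) (hp : IsEuler d p) : IsEuler (d - 1) (pderiv a p) := by
  rw [IsEuler, euler_pderiv, hp, Derivation.map_smul, sub_smul, one_smul]

theorem lap (hp : IsEuler d p) : IsEuler (d - 2) (lap p) := by
  rw [lap_apply]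
  refine sum fun i _ => ?_
  have := (hp.pderiv i).pderiv i
  rwa [sub_sub, one_add_one_eq_two] at this

theorem X_mul_pderiv (a b : Fin N) (hp : IsEuler d p) :
    IsEuler d (X a * MvPolynomial.pderiv b p) := by
  simpa using (hp.pderiv b).X_mul a

end IsEuler

theorem euler_monomial (s : Fin N →₀ ℕ) (c : k) :
    euler (monomial s c) = (s.degree : k) • monomial s c := by
  have h : ∀ i, X i * pderiv i (monomial s c) = (s i : k) • monomial s c := by
    intro i
    rw [MvPolynomial.X_mul_pderiv_monomial, Nat.cast_smul_eq_nsmul]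
  rw [euler_apply, Finset.sum_congr rfl fun i _ => h i, ← Finset.sum_smul,
    Finsupp.degree_eq_sum]
  push_cast
  rfl

theorem isEuler_monomial (s : Fin N →₀ ℕ) (c : k) : IsEuler (s.degree : k) (monomial s c) :=
  euler_monomial s c

theorem coeff_euler (s : Fin N →₀ ℕ) (p : MvPolynomial (Fin N) k) :
    coeff s (euler p) = s.degree * coeff s p := by
  induction p using MvPolynomial.induction_on' with
  | monomial t c =>
    rw [euler_monomial, coeff_smul, coeff_monomial, smul_eq_mul]
    split_ifs with h
    · rw [h]
    · simp
  | add p q hp hq => rw [map_add, coeff_add, hp, hq, coeff_add, mul_add]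

theorem IsEuler.degree_eq {d : k} {p : MvPolynomial (Fin N) k} (hp : IsEuler d p)
    {s : Fin N →₀ ℕ} (hs : coeff s p ≠ 0) : (s.degree : k) = d := by
  have h := coeff_euler s p
  rw [hp, coeff_smul, smul_eq_mul] at h
  exact (mul_right_cancel₀ hs h).symm

/-- Degrees live in `k`, so lowering a degree below zero needs no case split: a nonzero coefficient
would force the degree to be a natural number. -/
theorem IsEuler.eq_zero {d : k} {p : MvPolynomial (Fin N) k} (hp : IsEuler d p)
    (hd : ∀ n : ℕ, (n : k) ≠ d) : p = 0 := by
  ext s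
  by_contra hs
  exact hd _ (hp.degree_eq hs)

theorem exists_pderiv_ne_zero {d : k} (hd : d ≠ 0) {p : MvPolynomial (Fin N) k}
    (hp : IsEuler d p) (h0 : p ≠ 0) : ∃ i, pderiv i p ≠ 0 := by
  by_contra! h
  have : euler p = 0 := by simp [euler_apply, h]
  rw [hp, smul_eq_zero] at this
  tauto

variable [CharZero k]

theorem IsEuler.eq_C {p : MvPolynomial (Fin N) k} (hp : IsEuler 0 p) : ∃ c, p = C c := by
  refine ⟨coeff 0 p, ?_⟩
  ext s
  rw [coeff_C]
  split_ifs with h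
  · rw [h]
  · by_contra hs
    have h0 := hp.degree_eq hs
    rw [Nat.cast_eq_zero, Finsupp.degree_eq_zero_iff] at h0
    exact h h0.symm

theorem IsEuler.eq_sum {p : MvPolynomial (Fin N) k} (hp : IsEuler 1 p) :
    ∃ c : Fin N → k, p = ∑ i, c i • X i := by
  have h : ∀ i, ∃ c, MvPolynomial.pderiv i p = C c := fun i =>
    IsEuler.eq_C (by simpa using hp.pderiv i)
  choose c hc using h
  refine ⟨c, ?_⟩
  have h1 : euler p = p := by rw [hp, one_smul]
  rw [← h1, euler_apply]
  refine Finset.sum_congr rfl fun i _ => ?_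
  rw [hc, smul_eq_C_mul, mul_comm]

theorem IsEuler.lap_eq_zero {d : ℕ} (hd : d < 2) {p : MvPolynomial (Fin N) k}
    (hp : IsEuler (d : k) p) : SphereVF.lap p = 0 := by
  refine hp.lap.eq_zero fun n h => ?_
  have : ((n + 2 : ℕ) : k) = d := by
    push_cast
    rw [h]
    ring
  have := Nat.cast_injective this
  omega

/-- The operator `w ↦ c w + |x|² Δ w` is surjective on homogeneous polynomials. -/
theorem exists_smul_add_radSq_mul_lap (d c : ℕ) (hc : 0 < c) (g : MvPolynomial (Fin N) k)
    (hg : IsEuler (d : k) g) :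
    ∃ w, IsEuler (d : k) w ∧ (c : k) • w + radSq * lap w = g := by
  induction d using Nat.twoStepInduction generalizing c g with
  | zero | one =>
    have hc' : (c : k) ≠ 0 := by exact_mod_cast hc.ne'
    refine ⟨(c : k)⁻¹ • g, hg.smul _, ?_⟩
    rw [map_smul, hg.lap_eq_zero (by norm_num), smul_inv_smul₀ hc']
    simp
  | more d ih _ =>
    have hc' : (c : k) ≠ 0 := by exact_mod_cast hc.ne'
    -- Here u plays the role of Δw. Applying Δ to c w + |x|² Δw = g gives an equation of the same
    -- shape for u, with c increased by the 2N + 4d from `lap_radSq_mul`.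
    obtain ⟨u, hu, hu'⟩ := ih (c + 2 * N + 4 * d) (by omega) (lap g)
      (by simpa using hg.lap)
    have hRu : IsEuler ((d + 2 : ℕ) : k) (radSq * u) := by simpa using hu.radSq_mul
    refine ⟨(c : k)⁻¹ • (g - radSq * u), (hg.sub hRu).smul _, ?_⟩
    rw [smul_inv_smul₀ hc', map_smul, map_sub, lap_radSq_mul, hu, ← hu']
    have : (((c + 2 * N + 4 * d : ℕ) : k) • u + radSq * lap u
        - (radSq * lap u + 4 * (d : k) • u + 2 * (N : MvPolynomial (Fin N) k) * u)) =
        (c : k) • u := by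
      simp only [smul_eq_C_mul]
      push_cast
      simp only [map_add, map_mul, map_natCast, map_ofNat]
      ring
    rw [this, inv_smul_smul₀ hc']
    ring

/-- A homogeneous polynomial is the sum of a harmonic one and a multiple of `|x|²`. -/
theorem exists_harmonic_add (hN : 0 < N) (d : ℕ) (p : MvPolynomial (Fin N) k)
    (hp : IsEuler ((d + 2 : ℕ) : k) p) :
    ∃ h w, IsEuler ((d + 2 : ℕ) : k) h ∧ lap h = 0 ∧ IsEuler (d : k) w ∧ p = h + radSq * w := by
  -- The equation for w says exactly that Δ(p - |x|² w) = 0.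
  obtain ⟨w, hw, hw'⟩ := exists_smul_add_radSq_mul_lap d (2 * N + 4 * d) (by omega) (lap p)
    (by simpa using hp.lap)
  refine ⟨p - radSq * w, w, hp.sub (by simpa using hw.radSq_mul), ?_, hw, by ring⟩
  rw [map_sub, ← hw', lap_radSq_mul, hw]
  simp only [smul_eq_C_mul]
  push_cast
  simp only [map_add, map_mul, map_natCast, map_ofNat]
  ring

end Polynomials

/-! ### Stable subspaces: Laplacians, harmonic components, multiplication by quadratics -/

section Stable

variable {N : ℕ} {k : Type*} [Field k]

theorem toSphere_radSq : toSphere N k radSq = 1 := by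
  rw [radSq, map_sum, ← sum_coord_sq N k]
  simp [coord]

theorem toSphere_radSq_mul (p : MvPolynomial (Fin N) k) :
    toSphere N k (radSq * p) = toSphere N k p := by
  rw [map_mul, toSphere_radSq, one_mul]

/-- Summing x_c (x_c ∂_a - x_a ∂_c) over c gives |x|² ∂_a - x_a E, and |x|² becomes 1 on the sphere.
-/
theorem tau_toSphere (M : Matrix (Fin N) (Fin N) k) (p : MvPolynomial (Fin N) k) :
    tau N k M (toSphere N k p) =
      ∑ a, ∑ b, M a b • toSphere N k (X b * pderiv a p - X a * X b * euler p) := by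
  change (∑ a, ∑ b, M a b • ∑ c, (coord b * coord c : SphereAlg N k) • rot a c :
      Derivation k (SphereAlg N k) (SphereAlg N k)) (toSphere N k p) = _
  simp only [derivation_sum_apply, Derivation.smul_apply, rot_toSphere]
  refine Finset.sum_congr rfl fun a _ => Finset.sum_congr rfl fun b _ => ?_
  congr 1
  have h : X b * (radSq * pderiv a p) - X a * X b * euler p =
      ∑ c, X b * X c * rotPoly a c p := by
    simp only [radSq, euler_apply, rotPoly, Derivation.sub_apply, Derivation.smul_apply,
      smul_eq_mul, Finset.sum_mul, Finset.mul_sum, ← Finset.sum_sub_distrib]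
    refine Finset.sum_congr rfl fun c _ => ?_
    ring
  rw [map_sub, map_mul _ (X b), ← toSphere_radSq_mul (pderiv a p), ← map_mul _ (X b), ← map_sub,
    h, map_sum]
  simp [coord]

theorem tau_single_toSphere (a b : Fin N) (p : MvPolynomial (Fin N) k) :
    tau N k (Matrix.single a b 1) (toSphere N k p) =
      toSphere N k (X b * pderiv a p - X a * X b * euler p) := by
  rw [tau_toSphere, Finset.sum_eq_single a, Finset.sum_eq_single b]
  · simp
  · intro c _ hc
    simp [Matrix.single, Ne.symm hc]
  · simp
  · intro c _ hc
    simp [Matrix.single, Ne.symm hc]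
  · simp

theorem tau_single_sub_single (a b : Fin N) (f : SphereAlg N k) :
    tau N k (Matrix.single a b 1 - Matrix.single b a 1) f = rot a b f := by
  obtain ⟨p, rfl⟩ := Ideal.Quotient.mkₐ_surjective k _ f
  change tau N k _ (toSphere N k p) = rot a b (toSphere N k p)
  rw [map_sub, Derivation.sub_apply, tau_single_toSphere, tau_single_toSphere, rot_toSphere,
    ← map_sub, rotPoly]
  congr 1
  simp only [Derivation.sub_apply, Derivation.smul_apply, smul_eq_mul]
  ring

/-- Subspaces stable under the action of `sl_N`. -/
def TauStable (W : Submodule k (SphereAlg N k)) : Prop :=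
  ∀ M : Matrix (Fin N) (Fin N) k, M.trace = 0 → ∀ f ∈ W, tau N k M f ∈ W

variable {W : Submodule k (SphereAlg N k)}

namespace TauStable

theorem rot_mem (hW : TauStable W) (a b : Fin N) {f : SphereAlg N k} (hf : f ∈ W) :
    rot a b f ∈ W := by
  rw [← tau_single_sub_single]
  refine hW _ ?_ f hf
  by_cases h : a = b
  · simp [h]
  · simp [Matrix.trace_sub, Matrix.trace_single_eq_of_ne, h, Ne.symm h]

variable [CharZero k]

/-- On the image of p, the Casimir operator is twice Δp - d(d + N - 2)p. The Laplacian does not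
descend to the sphere algebra, so the homogeneous representative matters: replacing p by |x|² p
changes the result. -/
theorem lap_mem (hW : TauStable W) {d : k} {p : MvPolynomial (Fin N) k} (hp : IsEuler d p)
    (h : toSphere N k p ∈ W) : toSphere N k (lap p) ∈ W := by
  have h1 : toSphere N k (∑ a, ∑ b, rotPoly a b (rotPoly a b p)) ∈ W := by
    simp only [map_sum]
    refine Submodule.sum_mem _ fun a _ => Submodule.sum_mem _ fun b _ => ?_
    rw [← rot_toSphere, ← rot_toSphere]
    exact hW.rot_mem a b (hW.rot_mem a b h)
  have h2 : toSphere N k (∑ a, ∑ b, rotPoly a b (rotPoly a b p)) =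
      (2 : k) • (toSphere N k (lap p) - (d * d + (N - 2) * d) • toSphere N k p) := by
    rw [sum_rotPoly_rotPoly, hp, map_smul, hp, ← toSphere_radSq_mul (lap p), ← map_smul,
      ← map_sub, ← map_smul]
    congr 1
    simp only [smul_eq_C_mul]
    simp only [map_add, map_sub, map_mul, map_natCast, map_ofNat]
    ring
  rw [h2, Submodule.smul_mem_iff _ two_ne_zero] at h1
  exact (Submodule.sub_mem_iff_left _ (W.smul_mem _ h)).mp h1

/-- Applying `lap_mem` to c w + |x|² Δw yields the same expression for Δw, with a larger positive
constant. By induction Δw is in W, and then so is w. -/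
theorem mem_of_smul_add (hW : TauStable W) (d c : ℕ) (hc : 0 < c) (w : MvPolynomial (Fin N) k)
    (hw : IsEuler (d : k) w) (h : toSphere N k ((c : k) • w + radSq * lap w) ∈ W) :
    toSphere N k w ∈ W := by
  induction d using Nat.twoStepInduction generalizing c w with
  | zero | one =>
    have hc' : (c : k) ≠ 0 := by exact_mod_cast hc.ne'
    rw [hw.lap_eq_zero (by norm_num), mul_zero, add_zero, map_smul,
      Submodule.smul_mem_iff _ hc'] at h
    exact h
  | more d ih _ =>
    have hc' : (c : k) ≠ 0 := by exact_mod_cast hc.ne'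
    have hlw : IsEuler (d : k) (lap w) := by simpa using hw.lap
    have hE : IsEuler ((d + 2 : ℕ) : k) ((c : k) • w + radSq * lap w) :=
      (hw.smul _).add (by simpa using hlw.radSq_mul)
    have h1 := ih (c + 2 * N + 4 * d) (by omega) (lap w) hlw (by
      convert hW.lap_mem hE h using 2
      rw [map_add, map_smul, lap_radSq_mul, hlw]
      simp only [smul_eq_C_mul]
      push_cast
      simp only [map_add, map_mul, map_natCast, map_ofNat]
      ring)
    rw [map_add, map_smul, toSphere_radSq_mul, Submodule.add_mem_iff_left _ h1,
      Submodule.smul_mem_iff _ hc'] at h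
    exact h

/-- The harmonic decomposition of an element of a stable subspace stays in the subspace. -/
theorem exists_harmonic_add (hW : TauStable W) (hN : 0 < N) (d : ℕ)
    (p : MvPolynomial (Fin N) k) (hp : IsEuler ((d + 2 : ℕ) : k) p) (h : toSphere N k p ∈ W) :
    ∃ u w, IsEuler ((d + 2 : ℕ) : k) u ∧ lap u = 0 ∧ IsEuler (d : k) w ∧ p = u + radSq * w ∧
      toSphere N k u ∈ W ∧ toSphere N k w ∈ W := by
  obtain ⟨u, w, hu, hu0, hw, rfl⟩ := SphereVF.exists_harmonic_add hN d p hp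
  have h1 : toSphere N k w ∈ W := by
    refine hW.mem_of_smul_add d (2 * N + 4 * d) (by omega) w hw ?_
    convert hW.lap_mem hp h using 2
    rw [map_add, hu0, lap_radSq_mul, hw]
    simp only [smul_eq_C_mul]
    push_cast
    simp only [map_add, map_mul, map_natCast, map_ofNat]
    ring
  refine ⟨u, w, hu, hu0, hw, rfl, ?_, h1⟩
  rwa [map_add, toSphere_radSq_mul, Submodule.add_mem_iff_left _ h1] at h

/-- This separates the degrees mixed by a symmetric matrix. Two Laplacians isolate s, with the
nonzero factor 8(N + l - 2); then u and g are recovered in turn. -/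
theorem mem_of_sub_smul_mem (hW : TauStable W) (hN : 2 ≤ N) {l : ℕ} (hl : 1 ≤ l)
    {g u s : MvPolynomial (Fin N) k} (hg : IsEuler ((l : k) + 2) g) (hu : IsEuler (l : k) u)
    (hs : IsEuler ((l : k) - 2) s) (hgu : lap g = 4 * u) (hus : lap u = 2 * s) (hs0 : lap s = 0)
    (h : toSphere N k (u - (l : k) • g) ∈ W) : toSphere N k g ∈ W := by
  have hl0 : (l : k) ≠ 0 := by exact_mod_cast (by omega : l ≠ 0)
  have hN0 : (2 * N : k) ≠ 0 := by exact_mod_cast (by omega : 2 * N ≠ 0)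
  have hlN : (8 * (N + l - 2) : k) ≠ 0 := by
    have : ((8 * (N - 2 + l) : ℕ) : k) ≠ 0 := by exact_mod_cast (by omega : 8 * (N - 2 + l) ≠ 0)
    intro h0
    apply this
    rw [← h0]
    push_cast [Nat.cast_sub hN]
    ring
  have h1 : toSphere N k ((2 * N : k) • u + (2 : k) • (radSq * s)) ∈ W := by
    -- The factor |x|² makes the expression homogeneous of degree l + 2. Under Δ the two terms 4l u
    -- cancel.
    have h2 : toSphere N k (radSq * u - (l : k) • g) ∈ W := by
      rwa [map_sub, toSphere_radSq_mul, ← map_sub]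
    convert hW.lap_mem (hu.radSq_mul.sub (hg.smul _)) h2 using 2
    rw [map_sub, map_smul, lap_radSq_mul, hu, hgu, hus]
    simp only [smul_eq_C_mul]
    simp only [map_mul, map_natCast, map_ofNat]
    ring
  have hE : IsEuler (l : k) ((2 * N : k) • u + (2 : k) • (radSq * s)) :=
    (hu.smul _).add (by simpa using hs.radSq_mul.smul 2)
  have h2 : toSphere N k ((8 * (N + l - 2) : k) • s) ∈ W := by
    convert hW.lap_mem hE h1 using 2
    rw [map_add, map_smul, map_smul, lap_radSq_mul, hs, hs0, hus]
    simp only [smul_eq_C_mul]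
    simp only [map_mul, map_add, map_sub, map_natCast, map_ofNat]
    ring
  rw [map_smul, Submodule.smul_mem_iff _ hlN] at h2
  rw [map_add, map_smul, map_smul, toSphere_radSq_mul,
    Submodule.add_mem_iff_left _ (W.smul_mem _ h2), Submodule.smul_mem_iff _ hN0] at h1
  rwa [map_sub, map_smul, Submodule.sub_mem_iff_right _ h1, Submodule.smul_mem_iff _ hl0] at h

/-- A stable subspace is stable under multiplication of its nonconstant harmonics by
quadratic polynomials. -/
theorem X_mul_X_mul_mem (hW : TauStable W) (hN : 2 ≤ N) {l : ℕ} (hl : 1 ≤ l)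
    {p : MvPolynomial (Fin N) k} (hp : IsEuler (l : k) p) (hp0 : lap p = 0)
    (h : toSphere N k p ∈ W) (a b : Fin N) : toSphere N k (X a * (X b * p)) ∈ W := by
  have htau : ∀ a b, tau N k (Matrix.single a b 1) (toSphere N k p) =
      toSphere N k (X b * pderiv a p - (l : k) • (X a * (X b * p))) := by
    intro a b
    rw [tau_single_toSphere, hp, mul_smul_comm, mul_assoc]
  have hE : ∀ a b, IsEuler ((l : k) + 2) (X a * (X b * p)) := by
    intro a b
    rw [← one_add_one_eq_two, ← add_assoc]
    exact (hp.X_mul b).X_mul a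
  have hd : ∀ a b, IsEuler ((l : k) - 2) (pderiv a (pderiv b p)) := by
    intro a b
    rw [← one_add_one_eq_two, ← sub_sub]
    exact (hp.pderiv b).pderiv a
  have hdl : ∀ a b, lap (pderiv a (pderiv b p)) = 0 := by
    intro a b
    rw [← pderiv_lap, ← pderiv_lap, hp0, map_zero, map_zero]
  have hXd : ∀ a b, lap (X a * pderiv b p) = 2 * pderiv a (pderiv b p) := by
    intro a b
    rw [lap_X_mul, ← pderiv_lap, hp0, map_zero, mul_zero, zero_add]
  have hXX : ∀ a b, lap (X a * (X b * p)) =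
      2 * (X a * pderiv b p + X b * pderiv a p + if a = b then p else 0) := by
    intro a b
    rw [lap_X_mul, lap_X_mul, hp0, pderiv_X_mul]
    ring
  -- For a symmetric matrix the second-degree multiplier is g, the first-order part is u and the
  -- second derivatives of p give s.
  have hne : ∀ a b, a ≠ b → toSphere N k (X a * (X b * p)) ∈ W := by
    intro a b hab
    have h1 := hW (Matrix.single a b 1 + Matrix.single b a 1)
      (by simp [Matrix.trace_add, Matrix.trace_single_eq_of_ne, hab, hab.symm]) _ h
    rw [map_add, Derivation.add_apply, htau, htau, ← map_add] at h1
    have := hW.mem_of_sub_smul_mem hN hl ((hE a b).smul (2 : k))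
      ((hp.X_mul_pderiv a b).add (hp.X_mul_pderiv b a)) ((hd a b).smul (2 : k))
      (by
        rw [map_smul, hXX, if_neg hab]
        simp only [smul_eq_C_mul, map_ofNat]
        ring)
      (by
        rw [map_add, hXd, hXd, pderiv_comm b a]
        simp only [smul_eq_C_mul, map_ofNat]
        ring)
      (by rw [map_smul, hdl, smul_zero])
      (by
        convert h1 using 2
        simp only [smul_eq_C_mul, map_ofNat]
        ring)
    rwa [map_smul, Submodule.smul_mem_iff _ two_ne_zero] at this
  have hsub : ∀ a b, toSphere N k (X a * (X a * p) - X b * (X b * p)) ∈ W := by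
    intro a b
    have h1 := hW (Matrix.single a a 1 - Matrix.single b b 1)
      (by simp [Matrix.trace_sub]) _ h
    rw [map_sub, Derivation.sub_apply, htau, htau, ← map_sub] at h1
    refine hW.mem_of_sub_smul_mem hN hl ((hE a a).sub (hE b b))
      ((hp.X_mul_pderiv a a).sub (hp.X_mul_pderiv b b)) ((hd a a).sub (hd b b)) ?_ ?_ ?_ ?_
    · rw [map_sub, hXX, hXX, if_pos rfl, if_pos rfl]
      ring
    · rw [map_sub, hXd, hXd]
      ring
    · rw [map_sub, hdl, hdl, sub_zero]
    · convert h1 using 2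
      rw [smul_sub]
      ring
  by_cases hab : a = b
  · subst hab
    -- Traceless diagonal matrices give only differences of squares; their sum over b is N x_a² p -
    -- |x|² p, and |x|² p has the image of p, already in W.
    have h1 : toSphere N k (∑ b, (X a * (X a * p) - X b * (X b * p))) ∈ W := by
      rw [map_sum]
      exact W.sum_mem fun b _ => hsub a b
    have h2 : ∑ b, (X a * (X a * p) - X b * (X b * p)) =
        (N : k) • (X a * (X a * p)) - radSq * p := by
      rw [Finset.sum_sub_distrib, radSq, Finset.sum_mul]
      simp [smul_eq_C_mul, pow_two, mul_assoc]
    rw [h2, map_sub, toSphere_radSq_mul, Submodule.sub_mem_iff_left _ h, map_smul,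
      Submodule.smul_mem_iff _ (by exact_mod_cast (by omega : N ≠ 0))] at h1
    exact h1
  · exact hne a b hab

theorem X_mul_X_mul_mem_of_isEuler (hW : TauStable W) (hN : 2 ≤ N) (d : ℕ)
    (hd : Even d → ∀ a b, toSphere N k (X a * X b) ∈ W) {p : MvPolynomial (Fin N) k}
    (hp : IsEuler (d : k) p) (h : toSphere N k p ∈ W) (a b : Fin N) :
    toSphere N k (X a * (X b * p)) ∈ W := by
  induction d using Nat.twoStepInduction generalizing p with
  | zero =>
    obtain ⟨c, rfl⟩ := IsEuler.eq_C (by simpa using hp)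
    -- A constant component is killed by the action, so this case relies on the assumption `hd`
    -- about the products x_a x_b.
    rw [← mul_assoc, mul_comm, ← smul_eq_C_mul, map_smul]
    exact W.smul_mem _ (hd Even.zero a b)
  | one => exact hW.X_mul_X_mul_mem hN le_rfl hp (hp.lap_eq_zero one_lt_two) h a b
  | more d ih _ =>
    obtain ⟨u, w, hu, hu0, hw, rfl, huW, hwW⟩ := hW.exists_harmonic_add (by omega) d p hp h
    have h1 := hW.X_mul_X_mul_mem hN (by omega) hu hu0 huW a b
    have h2 := ih (fun he => hd (he.add even_two)) hw hwW
    have h3 : X a * (X b * (u + radSq * w)) =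
        X a * (X b * u) + radSq * (X a * (X b * w)) := by ring
    rw [h3, map_add, toSphere_radSq_mul]
    exact W.add_mem h1 h2

/-- A nonconstant element has a nonconstant harmonic component. -/
theorem exists_harmonic_ne_zero (hW : TauStable W) (hN : 2 ≤ N) (d : ℕ)
    {p : MvPolynomial (Fin N) k} (hp : IsEuler (d : k) p) (h : toSphere N k p ∈ W)
    (hc : ∀ c, toSphere N k p ≠ algebraMap k _ c) :
    ∃ l : ℕ, 1 ≤ l ∧ l % 2 = d % 2 ∧ ∃ u : MvPolynomial (Fin N) k, IsEuler (l : k) u ∧ lap u = 0 ∧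
      u ≠ 0 ∧ toSphere N k u ∈ W := by
  induction d using Nat.twoStepInduction generalizing p with
  | zero =>
    obtain ⟨c, rfl⟩ := IsEuler.eq_C (by simpa using hp)
    exact absurd ((toSphere N k).commutes c) (hc c)
  | one =>
    refine ⟨1, le_rfl, rfl, p, hp, hp.lap_eq_zero one_lt_two, ?_, h⟩
    rintro rfl
    exact hc 0 (by simp)
  | more d ih _ =>
    obtain ⟨u, w, hu, hu0, hw, rfl, huW, hwW⟩ := hW.exists_harmonic_add (by omega) d p hp h
    by_cases h0 : u = 0
    · rw [h0, zero_add, toSphere_radSq_mul] at hc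
      obtain ⟨l, hl, hl2, hu⟩ := ih hw hwW hc
      exact ⟨l, hl, by omega, hu⟩
    · exact ⟨d + 2, by omega, rfl, u, hu, hu0, h0, huW⟩

theorem lap_X_mul_X_mul_mem (hW : TauStable W) (hN : 2 ≤ N) {l : ℕ} (hl : 1 ≤ l)
    {p : MvPolynomial (Fin N) k} (hp : IsEuler (l : k) p) (hp0 : lap p = 0)
    (h : toSphere N k p ∈ W) (a b : Fin N) : toSphere N k (lap (X a * (X b * p))) ∈ W :=
  hW.lap_mem ((hp.X_mul b).X_mul a) (hW.X_mul_X_mul_mem hN hl hp hp0 h a b)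

/-- For harmonic p, the double Laplacian of x_a x_b p is 8 ∂_a ∂_b p. This lowers degrees by two
while staying harmonic. -/
theorem pderiv_pderiv_mem (hW : TauStable W) (hN : 2 ≤ N) {l : ℕ} (hl : 1 ≤ l)
    {p : MvPolynomial (Fin N) k} (hp : IsEuler (l : k) p) (hp0 : lap p = 0)
    (h : toSphere N k p ∈ W) (a b : Fin N) : toSphere N k (pderiv a (pderiv b p)) ∈ W := by
  have h1 := hW.lap_mem ((hp.X_mul b).X_mul a).lap (hW.lap_X_mul_X_mul_mem hN hl hp hp0 h a b)
  have h2 : lap (lap (X a * (X b * p))) = (8 : k) • pderiv a (pderiv b p) := by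
    rw [lap_X_mul, lap_X_mul, hp0, pderiv_X_mul]
    simp only [two_mul, mul_add, map_add, lap_X_mul, mul_zero, zero_add, ← pderiv_lap, hp0,
      map_zero, pderiv_comm b a, smul_eq_C_mul, map_ofNat]
    split_ifs
    · simp only [hp0]
      ring
    · simp only [map_zero]
      ring
  rw [h2, map_smul, Submodule.smul_mem_iff _ (by norm_num)] at h1
  exact h1

/-- Nonzero harmonics of a stable subspace produce harmonics of degree `1` or `2`. -/
theorem exists_harmonic_of_degree (hW : TauStable W) (hN : 2 ≤ N) (e : ℕ) (he : 1 ≤ e) (he2 : e ≤ 2)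
    (n : ℕ) {p : MvPolynomial (Fin N) k} (hp : IsEuler ((e + 2 * n : ℕ) : k) p) (hp0 : lap p = 0)
    (hne : p ≠ 0) (h : toSphere N k p ∈ W) :
    ∃ u : MvPolynomial (Fin N) k, IsEuler (e : k) u ∧ lap u = 0 ∧ u ≠ 0 ∧ toSphere N k u ∈ W := by
  induction n generalizing p with
  | zero => exact ⟨p, by simpa using hp, hp0, hne, h⟩
  | succ n ih =>
    obtain ⟨b, hb⟩ := exists_pderiv_ne_zero (Nat.cast_ne_zero.mpr (by omega)) hp hne
    have hE1 : IsEuler ((e + 2 * n + 1 : ℕ) : k) (pderiv b p) := by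
      convert hp.pderiv b using 1
      push_cast
      ring
    obtain ⟨a, ha⟩ := exists_pderiv_ne_zero (Nat.cast_ne_zero.mpr (by omega)) hE1 hb
    refine ih ?_ ?_ ha (hW.pderiv_pderiv_mem hN (by omega) hp hp0 h a b)
    · convert hE1.pderiv a using 1
      push_cast
      ring
    · rw [← pderiv_lap, ← pderiv_lap, hp0, map_zero, map_zero]

end TauStable

/-- For `N ≥ 3`, linear forms are an irreducible representation of the rotations. -/
theorem coord_mem_of_rot_mem (hN : 3 ≤ N) (hW : ∀ a b, ∀ f ∈ W, rot a b f ∈ W) (c : Fin N → k)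
    (hc : c ≠ 0) (h : ∑ i, c i • coord i ∈ W) (d : Fin N) : (coord d : SphereAlg N k) ∈ W := by
  obtain ⟨a, ha⟩ := Function.ne_iff.mp hc
  have h1 : ∀ d, d ≠ a → (coord d : SphereAlg N k) ∈ W := by
    intro d hda
    -- With a third index b, the rotation (a,b) followed by (b,d) sends x_a to x_d and kills every
    -- other term.
    obtain ⟨b, hb⟩ : ∃ b, b ∉ ({a, d} : Finset (Fin N)) := by
      by_contra! hall
      have h2 := Finset.card_le_card (fun x _ => hall x : Finset.univ ⊆ ({a, d} : Finset (Fin N)))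
      have h3 : ({a, d} : Finset (Fin N)).card ≤ 2 := Finset.card_le_two
      rw [Finset.card_univ, Fintype.card_fin] at h2
      omega
    simp only [Finset.mem_insert, Finset.mem_singleton, not_or] at hb
    have h2 := hW b d _ (hW a b _ h)
    have h3 : rot b d (rot a b (∑ i, c i • coord i)) = c a • (coord d : SphereAlg N k) := by
      simp only [map_sum, Derivation.map_smul, rot_coord, smul_sub, smul_ite, smul_zero,
        Finset.sum_sub_distrib, Finset.sum_ite_eq', Finset.mem_univ, if_true, map_sub]
      simp [hb.2, Ne.symm hb.1, Ne.symm hda]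
    rw [h3, Submodule.smul_mem_iff _ ha] at h2
    exact h2
  by_cases hda : d = a
  · subst hda
    obtain ⟨b, hb⟩ : ∃ b, b ≠ d := by
      have : Nontrivial (Fin N) := Fin.nontrivial_iff_two_le.mpr (by omega)
      exact exists_ne d
    have := hW b d _ (h1 b hb)
    simpa [rot_coord, hb] using this
  · exact h1 d hda

end Stable

/-! ### Parity decomposition and generation of each part -/

section Parity

variable {N : ℕ} {k : Type*} [Field k]

variable (N k) in
/-- The span of the images of the monomials of degrees `e, e + 2, e + 4, …`. -/
def parityPart (e : ℕ) : Submodule k (SphereAlg N k) :=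
  Submodule.span k {f | ∃ (s : Fin N →₀ ℕ) (i : ℕ), s.degree = e + 2 * i ∧
    f = toSphere N k (monomial s 1)}

theorem oddPart_eq : oddPart N k = parityPart N k 1 := by
  rw [oddPart, parityPart]
  congr 1
  ext f
  refine exists_congr fun s => ?_
  rw [exists_and_right]
  refine and_congr_left fun _ => exists_congr fun i => ?_
  omega

theorem evenPart_eq : evenPart N k = parityPart N k 0 := by
  rw [evenPart, parityPart]
  congr 1
  ext f
  refine exists_congr fun s => ?_
  rw [exists_and_right]
  refine and_congr_left fun _ => exists_congr fun i => ?_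
  omega

/-- The automorphism induced by the antipodal map. -/
def antipode : SphereAlg N k →ₐ[k] SphereAlg N k :=
  Ideal.Quotient.liftₐ _ ((toSphere N k).comp (aeval fun i => -X i)) (by
    intro a ha
    obtain ⟨g, rfl⟩ := Ideal.mem_span_singleton'.mp ha
    have h : (aeval fun i => -X i) ((∑ i : Fin N, X i ^ 2) - 1 : MvPolynomial (Fin N) k) =
        (radSq - 1 : MvPolynomial (Fin N) k) := by
      simp [radSq]
    rw [AlgHom.comp_apply, map_mul, h, map_mul, map_sub, toSphere_radSq, map_one, sub_self,
      mul_zero])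

theorem antipode_toSphere (p : MvPolynomial (Fin N) k) :
    antipode (toSphere N k p) = toSphere N k (aeval (fun i => -X i) p) := rfl

/-- The sign distinguishes the parities, so an element of both parts equals its own negative. -/
theorem antipode_apply {e : ℕ} {f : SphereAlg N k} (hf : f ∈ parityPart N k e) :
    antipode f = (-1) ^ e * f := by
  induction hf using Submodule.span_induction with
  | mem f hf =>
    obtain ⟨s, i, hs, rfl⟩ := hf
    have h : aeval (fun i => -X i) (monomial s (1 : k)) =
        ((-1) ^ e * monomial s 1 : MvPolynomial (Fin N) k) := by
      have h1 : ((-1) ^ e : MvPolynomial (Fin N) k) = (-1) ^ s.degree := by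
        rw [hs, pow_add, pow_mul]
        simp
      rw [aeval_monomial, h1, monomial_eq, Finsupp.degree_eq_sum, ← Finset.prod_pow_eq_pow_sum]
      simp only [Finsupp.prod_fintype, pow_zero, implies_true, map_one, one_mul]
      rw [← Finset.prod_mul_distrib]
      exact Finset.prod_congr rfl fun i _ => neg_pow (X i) (s i)
    rw [antipode_toSphere, h, map_mul, map_pow, map_neg, map_one]
  | zero => simp
  | add f g _ _ hf hg => rw [map_add, hf, hg, mul_add]
  | smul c f _ hf => rw [map_smul, hf, mul_smul_comm]

theorem parityPart_sup : parityPart N k 1 ⊔ parityPart N k 0 = ⊤ := by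
  rw [eq_top_iff]
  rintro f -
  obtain ⟨p, rfl⟩ := Ideal.Quotient.mkₐ_surjective k _ f
  change toSphere N k p ∈ _
  induction p using MvPolynomial.induction_on' with
  | monomial s c =>
    rw [← mul_one c, ← smul_eq_mul, ← smul_monomial, map_smul]
    refine Submodule.smul_mem _ _ ?_
    rcases Nat.even_or_odd' s.degree with ⟨i, hi | hi⟩
    · exact Submodule.mem_sup_right (Submodule.subset_span ⟨s, i, by omega, rfl⟩)
    · exact Submodule.mem_sup_left (Submodule.subset_span ⟨s, i, by omega, rfl⟩)
  | add p q hp hq =>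
    rw [map_add]
    exact Submodule.add_mem _ hp hq

/-- Powers of |x|² are invisible on the sphere and bring summands to a common degree. -/
theorem exists_isEuler {e : ℕ} {f : SphereAlg N k} (hf : f ∈ parityPart N k e) :
    ∃ (i : ℕ) (p : MvPolynomial (Fin N) k), IsEuler ((e + 2 * i : ℕ) : k) p ∧
      toSphere N k p = f := by
  have hpow : ∀ (i j : ℕ) (p : MvPolynomial (Fin N) k), IsEuler ((e + 2 * i : ℕ) : k) p →
      IsEuler ((e + 2 * (i + j) : ℕ) : k) (radSq ^ j * p) ∧
        toSphere N k (radSq ^ j * p) = toSphere N k p := by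
    intro i j p hp
    refine ⟨?_, by rw [map_mul, map_pow, toSphere_radSq, one_pow, one_mul]⟩
    convert hp.radSq_pow_mul j using 1
    push_cast
    ring
  induction hf using Submodule.span_induction with
  | mem f hf =>
    obtain ⟨s, i, hs, rfl⟩ := hf
    exact ⟨i, monomial s 1, hs ▸ isEuler_monomial s 1, rfl⟩
  | zero => exact ⟨0, 0, by simp [IsEuler], map_zero _⟩
  | add f g _ _ hf hg =>
    obtain ⟨i, p, hp, rfl⟩ := hf
    obtain ⟨j, q, hq, rfl⟩ := hg
    obtain ⟨hp1, hp2⟩ := hpow i j p hp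
    obtain ⟨hq1, hq2⟩ := hpow j i q hq
    rw [add_comm j i] at hq1
    exact ⟨i + j, _, hp1.add hq1, by rw [map_add, hp2, hq2]⟩
  | smul c f _ hf =>
    obtain ⟨i, p, hp, rfl⟩ := hf
    exact ⟨i, c • p, hp.smul c, map_smul _ _ _⟩

/-- Evaluation at a point of the sphere. -/
def evalPoint (v : Fin N → k) (hv : ∑ i, v i ^ 2 = 1) : SphereAlg N k →ₐ[k] k :=
  Ideal.Quotient.liftₐ _ (aeval v) (by
    intro a ha
    obtain ⟨g, rfl⟩ := Ideal.mem_span_singleton'.mp ha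
    simp [hv])

theorem evalPoint_coord (v : Fin N → k) (hv : ∑ i, v i ^ 2 = 1) (i : Fin N) :
    evalPoint v hv (coord i) = v i := by
  change aeval v (X i) = v i
  simp

theorem sum_single_sq (a : Fin N) : ∑ i, (Pi.single a (1 : k) : Fin N → k) i ^ 2 = 1 := by
  simp [Pi.single_apply]

theorem nontrivial_sphereAlg (hN : 0 < N) : Nontrivial (SphereAlg N k) :=
  (evalPoint (k := k) _ (sum_single_sq ⟨0, hN⟩)).toRingHom.domain_nontrivial

theorem coord_mem_parityPart (a : Fin N) : (coord a : SphereAlg N k) ∈ parityPart N k 1 :=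
  Submodule.subset_span ⟨Finsupp.single a 1, 0, by simp, rfl⟩

theorem one_mem_parityPart : (1 : SphereAlg N k) ∈ parityPart N k 0 :=
  Submodule.subset_span ⟨0, 0, by simp, by simp⟩

theorem algebraMap_mem_parityPart (c : k) :
    algebraMap k (SphereAlg N k) c ∈ parityPart N k 0 := by
  rw [Algebra.algebraMap_eq_smul_one]
  exact Submodule.smul_mem _ _ one_mem_parityPart

theorem coord_ne_zero (a : Fin N) : (coord a : SphereAlg N k) ≠ 0 := by
  intro h
  have := evalPoint_coord (k := k) _ (sum_single_sq a) a
  simp [h] at this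

/-- The values at the unit vectors e_a and e_b are 1 and 0. -/
theorem coord_sq_ne_algebraMap {a b : Fin N} (hab : a ≠ b) (c : k) :
    (coord a ^ 2 : SphereAlg N k) ≠ algebraMap k _ c := by
  intro h
  have h1 := congrArg (evalPoint (k := k) _ (sum_single_sq a)) h
  have h2 := congrArg (evalPoint (k := k) _ (sum_single_sq b)) h
  rw [AlgHom.commutes, map_pow, evalPoint_coord] at h1 h2
  rw [← h2] at h1
  simp [hab] at h1

variable [CharZero k]

theorem parityPart_disjoint : Disjoint (parityPart N k 1) (parityPart N k 0) := by
  rw [Submodule.disjoint_def]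
  intro f h1 h0
  have h := (antipode_apply h1).symm.trans (antipode_apply h0)
  have h2 : (2 : k) • f = 0 := by
    rw [two_smul]
    linear_combination -h
  exact (smul_eq_zero.mp h2).resolve_left two_ne_zero

theorem toSphere_mem_parityPart {e i : ℕ} {p : MvPolynomial (Fin N) k}
    (hp : IsEuler ((e + 2 * i : ℕ) : k) p) : toSphere N k p ∈ parityPart N k e := by
  rw [p.as_sum, map_sum]
  refine Submodule.sum_mem _ fun s hs => ?_
  rw [← mul_one (coeff s p), ← smul_eq_mul, ← smul_monomial, map_smul]
  have h := Nat.cast_injective (hp.degree_eq (mem_support_iff.mp hs))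
  exact Submodule.smul_mem _ _ (Submodule.subset_span ⟨s, i, h, rfl⟩)

theorem tauStable_parityPart (e : ℕ) : TauStable (parityPart N k e) := by
  intro M _ f hf
  obtain ⟨i, p, hp, rfl⟩ := exists_isEuler hf
  rw [tau_toSphere]
  refine Submodule.sum_mem _ fun a _ => Submodule.sum_mem _ fun b _ => Submodule.smul_mem _ _ ?_
  rw [map_sub]
  refine Submodule.sub_mem _ (toSphere_mem_parityPart (hp.X_mul_pderiv b a)) ?_
  rw [hp, mul_smul_comm, map_smul, mul_assoc]
  refine Submodule.smul_mem _ _ (toSphere_mem_parityPart (i := i + 1) ?_)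
  convert (hp.X_mul b).X_mul a using 1
  push_cast
  ring

variable {W : Submodule k (SphereAlg N k)}

/-- A subspace containing all `x_a x_b f` for `f` in a parity part lying in it, and the lowest
degree of that part, contains the part. -/
theorem parityPart_le (e : ℕ)
    (h0 : ∀ p : MvPolynomial (Fin N) k, IsEuler (e : k) p → toSphere N k p ∈ W)
    (h : ∀ (i : ℕ) (p : MvPolynomial (Fin N) k), IsEuler ((e + 2 * i : ℕ) : k) p →
      toSphere N k p ∈ W → ∀ a b, toSphere N k (X a * (X b * p)) ∈ W) :
    parityPart N k e ≤ W := by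
  have key : ∀ (i : ℕ) (p : MvPolynomial (Fin N) k), IsEuler ((e + 2 * i : ℕ) : k) p →
      toSphere N k p ∈ W := by
    intro i
    induction i with
    | zero => exact fun p hp => h0 p (by simpa using hp)
    | succ i ih =>
      intro p hp
      have h1 : ∀ b, IsEuler ((e + 2 * i + 1 : ℕ) : k) (pderiv b p) := by
        intro b
        convert hp.pderiv b using 1
        push_cast
        ring
      have h2 : ∀ a b, IsEuler ((e + 2 * i : ℕ) : k) (pderiv b (pderiv a p)) := by
        intro a b
        convert (h1 a).pderiv b using 1
        push_cast
        ring
      -- Euler's identity used twice writes n(n - 1) p as the sum of x_a x_b ∂_b ∂_a p, where n = e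
      -- + 2(i + 1).
      rw [← Submodule.smul_mem_iff W (Nat.cast_ne_zero (R := k).mpr (by omega : e + 2 * (i + 1) ≠ 0)),
        ← map_smul, ← hp, euler_apply, map_sum]
      refine Submodule.sum_mem _ fun a _ => ?_
      rw [← Submodule.smul_mem_iff W (Nat.cast_ne_zero (R := k).mpr (by omega : e + 2 * i + 1 ≠ 0)),
        ← map_smul, ← mul_smul_comm, ← h1 a, euler_apply, Finset.mul_sum, map_sum]
      exact Submodule.sum_mem _ fun b _ => h i _ (h2 a b) (ih _ (h2 a b)) a b
  intro f hf
  obtain ⟨i, p, hp, rfl⟩ := exists_isEuler hf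
  exact key i p hp

namespace TauStable

theorem coord_mem_of_isEuler (hN : 3 ≤ N) (hW : ∀ a b, ∀ f ∈ W, rot a b f ∈ W)
    {u : MvPolynomial (Fin N) k} (hu : IsEuler 1 u) (hne : u ≠ 0) (h : toSphere N k u ∈ W)
    (d : Fin N) : (coord d : SphereAlg N k) ∈ W := by
  obtain ⟨c, rfl⟩ := hu.eq_sum
  refine coord_mem_of_rot_mem hN hW c ?_ ?_ d
  · rintro rfl
    simp at hne
  · simpa [coord] using h

theorem parityPart_one_le (hN : 3 ≤ N) (hW : TauStable W) {f : SphereAlg N k} (hf : f ∈ W)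
    (hf1 : f ∈ parityPart N k 1) (hne : f ≠ 0) : parityPart N k 1 ≤ W := by
  obtain ⟨i, p, hp, rfl⟩ := exists_isEuler hf1
  obtain ⟨l, hl, hl2, u, hu, hu0, hune, huW⟩ :=
    hW.exists_harmonic_ne_zero (by omega) _ hp hf (by
      -- A constant is even, so an odd constant function is zero.
      intro c hc
      refine hne (Submodule.disjoint_def.mp parityPart_disjoint _ hf1 ?_)
      rw [hc]
      exact algebraMap_mem_parityPart c)
  obtain ⟨j, rfl⟩ : ∃ j, l = 1 + 2 * j := ⟨l / 2, by omega⟩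
  obtain ⟨v, hv, -, hvne, hvW⟩ :=
    hW.exists_harmonic_of_degree (by omega) 1 le_rfl one_le_two j hu hu0 hune huW
  rw [Nat.cast_one] at hv
  have hcoord := coord_mem_of_isEuler hN (fun a b f hf => hW.rot_mem a b hf) hv hvne hvW
  refine parityPart_le 1 ?_ ?_
  · intro p hp
    obtain ⟨c, rfl⟩ := IsEuler.eq_sum (by simpa using hp)
    rw [map_sum]
    refine Submodule.sum_mem _ fun i _ => ?_
    rw [map_smul]
    exact Submodule.smul_mem _ _ (hcoord i)
  · intro i p hp hpW a b
    refine hW.X_mul_X_mul_mem_of_isEuler (by omega) (1 + 2 * i) ?_ hp hpW a b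
    intro he
    rw [Nat.even_iff] at he
    omega

/-- A stable subspace containing a nonzero harmonic quadratic form contains all quadratic
forms. -/
theorem X_mul_X_mem (hN : 3 ≤ N) (hW : TauStable W) {u : MvPolynomial (Fin N) k}
    (hu : IsEuler 2 u) (hu0 : lap u = 0) (hne : u ≠ 0) (h : toSphere N k u ∈ W) (a b : Fin N) :
    toSphere N k (X a * X b) ∈ W := by
  have hu' : IsEuler ((2 : ℕ) : k) u := by simpa using hu
  -- The Laplacian of x_a x_b u gives the symmetric combination of x_a ∂_b u and x_b ∂_a u, up to a
  -- multiple of u; the rotation gives the antisymmetric one.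
  have hmul : ∀ a b, toSphere N k (X a * pderiv b u) ∈ W := by
    intro a b
    have h1 := hW.lap_X_mul_X_mul_mem (by omega) one_le_two hu' hu0 h a b
    have h2 := hW.rot_mem a b h
    rw [rot_toSphere] at h2
    have h3 : lap (X a * (X b * u)) - (2 : k) • rotPoly a b u =
        (4 : k) • (X a * pderiv b u) + (if a = b then 2 else 0 : k) • u := by
      rw [lap_X_mul, lap_X_mul, hu0, pderiv_X_mul, rotPoly]
      simp only [Derivation.sub_apply, Derivation.smul_apply, smul_eq_mul, smul_eq_C_mul,
        map_ofNat]
      split_ifs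
      · simp only [map_ofNat]
        ring
      · simp only [map_zero]
        ring
    have h4 := W.sub_mem h1 (W.smul_mem 2 h2)
    rw [← map_smul, ← map_sub, h3, map_add, map_smul, map_smul,
      Submodule.add_mem_iff_left _ (W.smul_mem _ h), Submodule.smul_mem_iff _ (by norm_num : (4 : k) ≠ 0)] at h4
    exact h4
  obtain ⟨c, hc⟩ := exists_pderiv_ne_zero two_ne_zero hu hne
  -- Y collects the y with x_a y in W for all a. By the Leibniz rule it is stable under rotations,
  -- and it contains the nonzero linear form ∂_c u; hence it contains every coordinate.
  let Y : Submodule k (SphereAlg N k) := ⨅ a : Fin N, W.comap (LinearMap.mulLeft k (coord a))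
  have hY : ∀ y, y ∈ Y ↔ ∀ a, coord a * y ∈ W := by
    intro y
    simp [Y, Submodule.mem_iInf]
  have hYrot : ∀ a b, ∀ y ∈ Y, rot a b y ∈ Y := by
    intro a b y hy
    rw [hY] at hy ⊢
    intro i
    have h1 := hW.rot_mem a b (hy i)
    rw [Derivation.leibniz, smul_eq_mul, smul_eq_mul, rot_coord] at h1
    refine (Submodule.add_mem_iff_left _ ?_).mp h1
    rw [mul_comm, sub_mul]
    refine W.sub_mem ?_ ?_
    · split_ifs
      · exact hy b
      · simp
    · split_ifs
      · exact hy a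
      · simp
  have h1 : IsEuler (1 : k) (pderiv c u) := by
    convert hu.pderiv c using 1
    norm_num
  have h2 : toSphere N k (pderiv c u) ∈ Y := by
    rw [hY]
    intro a
    have := hmul a c
    rwa [map_mul] at this
  have h3 := (hY _).mp (coord_mem_of_isEuler hN hYrot h1 hc h2 b) a
  rwa [map_mul]

theorem parityPart_zero_le (hN : 3 ≤ N) (hW : TauStable W) {f : SphereAlg N k} (hf : f ∈ W)
    (hf0 : f ∈ parityPart N k 0) (hne : ∀ c, f ≠ algebraMap k _ c) : parityPart N k 0 ≤ W := by
  obtain ⟨i, p, hp, rfl⟩ := exists_isEuler hf0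
  obtain ⟨l, hl, hl2, u, hu, hu0, hune, huW⟩ :=
    hW.exists_harmonic_ne_zero (by omega) _ hp hf hne
  -- An even degree that is at least 1 is at least 2.
  obtain ⟨j, rfl⟩ : ∃ j, l = 2 + 2 * j := ⟨l / 2 - 1, by omega⟩
  obtain ⟨v, hv, hv0, hvne, hvW⟩ :=
    hW.exists_harmonic_of_degree (by omega) 2 one_le_two le_rfl j hu hu0 hune huW
  rw [Nat.cast_ofNat] at hv
  have hquad := hW.X_mul_X_mem hN hv hv0 hvne hvW
  -- The constants are reached through 1 = |x|² on the sphere.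
  have hone : (1 : SphereAlg N k) ∈ W := by
    rw [← toSphere_radSq, radSq, map_sum]
    refine Submodule.sum_mem _ fun i _ => ?_
    rw [pow_two]
    exact hquad i i
  refine parityPart_le 0 ?_ ?_
  · intro p hp
    obtain ⟨c, rfl⟩ := IsEuler.eq_C (by simpa using hp)
    rw [← mul_one (C c), ← smul_eq_C_mul, map_smul, map_one]
    exact Submodule.smul_mem _ _ hone
  · intro i p hp hpW a b
    exact hW.X_mul_X_mul_mem_of_isEuler (by omega) (0 + 2 * i) (fun _ => hquad) hp hpW a b

end TauStable

/-- A stable subspace as a Lie submodule. -/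
def TauStable.toLieSubmodule (hW : TauStable W) :
    LieSubmodule k (LieAlgebra.SpecialLinear.sl (Fin N) k) (SphereAlg N k) where
  toSubmodule := W
  lie_mem {M f} hf := by
    change -(tau N k M.val) f ∈ W
    exact W.neg_mem (hW _ M.2 f hf)

end Parity

/-! ### Lie submodules of a part as stable subspaces of the sphere algebra -/

section LieSubmodules

variable {N : ℕ} {k : Type*} [Field k]
  {U : LieSubmodule k (LieAlgebra.SpecialLinear.sl (Fin N) k) (SphereAlg N k)}
  (W : LieSubmodule k (LieAlgebra.SpecialLinear.sl (Fin N) k) U)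

theorem lie_def (M : LieAlgebra.SpecialLinear.sl (Fin N) k) (f : SphereAlg N k) :
    ⁅M, f⁆ = -tau N k M.val f := rfl

theorem tauStable_map_subtype : TauStable (W.toSubmodule.map U.toSubmodule.subtype) := by
  rintro M hM _ ⟨w, hw, rfl⟩
  let X : LieAlgebra.SpecialLinear.sl (Fin N) k := ⟨M, hM⟩
  let x : U := w
  refine ⟨-⁅X, x⁆, W.neg_mem (W.lie_mem hw), ?_⟩
  change -(⁅X, (x : SphereAlg N k)⁆) = _
  rw [lie_def, neg_neg]
  rfl

theorem eq_top_of_le_map_subtype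
    (h : U.toSubmodule ≤ W.toSubmodule.map U.toSubmodule.subtype) : W = ⊤ := by
  rw [eq_top_iff]
  intro x _
  obtain ⟨w, hw, hwx⟩ := h x.2
  have : w = x := Subtype.ext hwx
  exact this ▸ hw

theorem exists_mem_ne_zero (hW : W ≠ ⊥) : ∃ w ∈ W, w ≠ 0 := by
  by_contra! h
  exact hW ((LieSubmodule.eq_bot_iff W).mpr h)

end LieSubmodules

end SphereVF

end

/-! ### Main theorem -/

theorem mainTheorem8 (k : Type*) [Field k] [IsAlgClosed k] [CharZero k] (N : ℕ) (hN : 3 ≤ N) :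
    ∃ Aodd Aev : LieSubmodule k (LieAlgebra.SpecialLinear.sl (Fin N) k) (SphereVF.SphereAlg N k),
      Aodd.toSubmodule = SphereVF.oddPart N k ∧
      Aev.toSubmodule = SphereVF.evenPart N k ∧
      IsCompl Aodd Aev ∧
      LieModule.IsIrreducible k (LieAlgebra.SpecialLinear.sl (Fin N) k) Aodd ∧
      ∃ C : LieSubmodule k (LieAlgebra.SpecialLinear.sl (Fin N) k) Aev,
        (∀ W : LieSubmodule k (LieAlgebra.SpecialLinear.sl (Fin N) k) Aev,
          (W ≠ ⊥ ∧ W ≠ ⊤) ↔ W = C) ∧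
        Module.finrank k C = 1 ∧
        (∀ f : Aev, f ∈ C ↔ ∃ c : k,
          (f : SphereVF.SphereAlg N k) = algebraMap k (SphereVF.SphereAlg N k) c) := by
  open SphereVF in
  have hnt : Nontrivial (SphereAlg N k) := nontrivial_sphereAlg (by omega)
  let Aodd := (tauStable_parityPart (N := N) (k := k) 1).toLieSubmodule
  let Aev := (tauStable_parityPart (N := N) (k := k) 0).toLieSubmodule
  have hirr : LieModule.IsIrreducible k (LieAlgebra.SpecialLinear.sl (Fin N) k) Aodd := by
    have : Nontrivial Aodd := ⟨⟨⟨coord ⟨0, by omega⟩, coord_mem_parityPart _⟩, 0, fun h =>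
      coord_ne_zero _ (congrArg Subtype.val h)⟩⟩
    refine LieModule.IsIrreducible.mk fun W hW => ?_
    obtain ⟨w, hw, hw0⟩ := exists_mem_ne_zero W hW
    refine eq_top_of_le_map_subtype W ?_
    exact (tauStable_map_subtype W).parityPart_one_le hN ⟨w, hw, rfl⟩ w.2
      fun h => hw0 (Subtype.ext h)
  let C : LieSubmodule k (LieAlgebra.SpecialLinear.sl (Fin N) k) Aev :=
    { (LinearMap.range (Algebra.linearMap k (SphereAlg N k))).comap Aev.toSubmodule.subtype with
      lie_mem := by
        rintro M f ⟨c, hc⟩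
        refine ⟨0, ?_⟩
        have hc' : (f : SphereAlg N k) = algebraMap k _ c := hc.symm
        change _ = ⁅M, (f : SphereAlg N k)⁆
        rw [lie_def, hc', Derivation.map_algebraMap]
        simp }
  have hC : ∀ f : Aev, f ∈ C ↔ ∃ c : k, (f : SphereAlg N k) = algebraMap k _ c := fun f =>
    exists_congr fun c => eq_comm
  let v : Aev := ⟨1, one_mem_parityPart⟩
  have hv0 : v ≠ 0 := fun h => one_ne_zero (congrArg Subtype.val h)
  have hvC : v ∈ C := (hC v).mpr ⟨1, (map_one _).symm⟩
  have hspan : ∀ f ∈ C, ∃ c : k, c • v = f := by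
    intro f hf
    obtain ⟨c, hc⟩ := (hC f).mp hf
    refine ⟨c, Subtype.ext ?_⟩
    rw [hc, Algebra.algebraMap_eq_smul_one]
    rfl
  refine ⟨Aodd, Aev, oddPart_eq.symm, evenPart_eq.symm, ?_, hirr, C, ?_, ?_, hC⟩
  · rw [LieSubmodule.isCompl_toSubmodule.symm]
    exact ⟨parityPart_disjoint, codisjoint_iff.mpr parityPart_sup⟩
  · intro W
    constructor
    · rintro ⟨hbot, htop⟩
      have hle : W ≤ C := by
        intro f hf
        rw [hC]
        by_contra! hc
        refine htop (eq_top_of_le_map_subtype W ?_)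
        exact (tauStable_map_subtype W).parityPart_zero_le hN ⟨f, hf, rfl⟩ f.2 hc
      refine le_antisymm hle fun f hf => ?_
      obtain ⟨w, hw, hw0⟩ := exists_mem_ne_zero W hbot
      obtain ⟨c, rfl⟩ := hspan w (hle hw)
      obtain ⟨d, rfl⟩ := hspan f hf
      have hc : c ≠ 0 := by
        rintro rfl
        exact hw0 (zero_smul _ _)
      have := W.smul_mem (d * c⁻¹) hw
      rwa [smul_smul, inv_mul_cancel_right₀ hc] at this
    · rintro rfl
      refine ⟨fun h => hv0 ?_, fun h => ?_⟩
      · rwa [h, LieSubmodule.mem_bot] at hvC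
      -- The square of a coordinate is an even nonconstant function, so the constants are not
      -- everything.
      · have hmem : (coord ⟨0, by omega⟩ ^ 2 : SphereAlg N k) ∈ parityPart N k 0 :=
          Submodule.subset_span ⟨Finsupp.single ⟨0, by omega⟩ 2, 1, by simp, by
            rw [coord, ← map_pow, MvPolynomial.X_pow_eq_monomial]⟩
        have hm : (⟨_, hmem⟩ : Aev) ∈ C := h ▸ LieSubmodule.mem_top _
        obtain ⟨c, hc⟩ := (hC _).mp hm
        exact coord_sq_ne_algebraMap (b := ⟨1, by omega⟩) (by simp) c hc
  · refine finrank_eq_one (⟨v, hvC⟩ : C) (fun h => hv0 (congrArg Subtype.val h)) ?_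
    rintro ⟨f, hf⟩
    obtain ⟨c, hc⟩ := hspan f hf
    exact ⟨c, Subtype.ext hc⟩
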